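/- Let $0<\alpha<1$ and $\theta>-\alpha$. For real $x,a$ and integers $i\ge 0$ write $(x)_{i;a}=x(x+a)\cdots(x+(i-1)a)$, $(x)_{0;a}=1$, and $(x)_i=(x)_{i;1}$. The Ewens–Pitman partition $\Pi_n$ with parameters $(\alpha,\theta)$ is the random partition of $[n]=\{1,\dots,n\}$ with $$\mathbb P(\Pi_n=\{A_1,\dots,A_k\})=\frac{(\theta)_{k;\alpha}}{(\theta)_n}\prod_{i=1}^k(1-\alpha)_{|A_i|-1}$$ for every partition $\{A_1,\dots,A_k\}$ of $[n]$ into $k$ non-empty blocks, where for $\theta=0$ the ratio $(\theta)_{k;\alpha}/(\theta)_n$ is read as $(\theta+\alpha)_{k-1;\alpha}/(\theta+1)_{n-1}$. Let $|A_{(K_n)}|$ denote the size of the smallest block of $\Pi_n$, and let $p_\alpha(j)=\binom{\alpha}{j}(-1)^{j+1}$, $j=1,2,\dots$ (Sibuya's distribution). Here $f(n)\sim g(n)$ means that $f(n)/g(n)\to1$ as $n\to\infty$. (i) For every sequence of integers $r=r_n$ with $r_n\ge 2$ for all sufficiently large $n$ and $r_n=o(n)$ (in particular for every fixed $r\ge2$),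 $$\mathbb P(|A_{(K_n)}|\ge r)\sim\frac{\Gamma(1+\theta)}{\Gamma(1-\alpha)}\Bigl\{\sum_{j=1}^{r-1}p_\alpha(j)\Bigr\}^{-1-\theta/\alpha}n^{-\theta-\alpha},\qquad n\to\infty.$$ (ii) If moreover $r=r_n\to\infty$ (and $r_n=o(n)$), then $$\mathbb P(|A_{(K_n)}|\ge r)\sim\frac{\Gamma(1+\theta)}{\Gamma(1-\alpha)}\,n^{-\theta-\alpha},\qquad n\to\infty.$$ -/

import Mathlib

open Filter Asymptotics MeasureTheory

noncomputable section

/-- The partitions of the set `[n]` (modelled by `Fin n`) into non-empty disjoint blocks. -/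
abbrev SetPartition (n : ℕ) : Type := Finpartition (Finset.univ : Finset (Fin n))

instance (n : ℕ) : MeasurableSpace (SetPartition n) := ⊤

/-- The rising factorial with step `a`: `(x)_{i;a} = x (x + a) ⋯ (x + (i - 1) a)`, `(x)_{0;a} = 1`.
The ordinary rising factorial is `(x)_i = (x)_{i;1}`. -/
def risingStep (x a : ℝ) (i : ℕ) : ℝ := ∏ j ∈ Finset.range i, (x + j * a)

/-- The exchangeable partition probability function of the Ewens–Pitman partition: a partition
of `[n]` with `k` blocks `A_1, …, A_k` has probability
`(θ)_{k;α} / (θ)_n * ∏ i, (1 - α)_{|A_i| - 1}`. The factor `θ`, common to `(θ)_{k;α}` and `(θ)_n`,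
is cancelled, so that the ratio also has its usual meaning at `θ = 0`;
see `ewensPitmanEPPF_eq`. -/
def ewensPitmanEPPF (α θ : ℝ) (n : ℕ) (π : SetPartition n) : ℝ :=
  risingStep (θ + α) α (π.parts.card - 1) / risingStep (θ + 1) 1 (n - 1) *
    ∏ A ∈ π.parts, risingStep (1 - α) 1 (A.card - 1)

theorem risingStep_pred (x a : ℝ) {i : ℕ} (hi : 1 ≤ i) :
    risingStep x a i = x * risingStep (x + a) a (i - 1) := by
  obtain ⟨j, rfl⟩ : ∃ j, i = j + 1 := ⟨i - 1, by omega⟩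
  simp only [risingStep, Nat.add_sub_cancel, Finset.prod_range_succ', Nat.cast_zero, zero_mul,
    add_zero, Nat.cast_add, Nat.cast_one]
  rw [mul_comm]
  congr 1
  exact Finset.prod_congr rfl fun k _ => by ring

/-- For `θ ≠ 0` the probability function is the uncancelled expression. -/
theorem ewensPitmanEPPF_eq (α θ : ℝ) (hθ : θ ≠ 0) (n : ℕ) (hn : 1 ≤ n) (π : SetPartition n) :
    ewensPitmanEPPF α θ n π =
      risingStep θ α π.parts.card / risingStep θ 1 n *
        ∏ A ∈ π.parts, risingStep (1 - α) 1 (A.card - 1) := by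
  have hk : 1 ≤ π.parts.card := by
    rw [Nat.one_le_iff_ne_zero, Ne, Finset.card_eq_zero, Finpartition.parts_eq_empty_iff,
      Finset.bot_eq_empty]
    exact (Finset.univ_nonempty_iff.2 ⟨⟨0, hn⟩⟩).ne_empty
  rw [ewensPitmanEPPF, risingStep_pred θ α hk, risingStep_pred θ 1 hn, mul_div_mul_left _ _ hθ]

/-- The law of the Ewens–Pitman random partition `Π_n` of `[n]` with parameters `α`, `θ`. -/
def ewensPitman (α θ : ℝ) (n : ℕ) : Measure (SetPartition n) :=
  ∑ π : SetPartition n, ENNReal.ofReal (ewensPitmanEPPF α θ n π) • Measure.dirac π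

/-- The smallest size of a block of a partition of `[n]` (for `n ≥ 1`). -/
def smallestSize {n : ℕ} (π : SetPartition n) : ℕ := sInf {s | ∃ A ∈ π.parts, A.card = s}

/-- `P(|A_{(K_n)}| ≥ r)`: the probability that all blocks of the Ewens–Pitman partition of `[n]`
have size at least `r`. -/
def probSmallestGE (α θ : ℝ) (n r : ℕ) : ℝ :=
  (ewensPitman α θ n).real {π | r ≤ smallestSize π}

/-- Sibuya's distribution `p_α(j) = (α choose j) (-1)^(j + 1)`, `j = 1, 2, …`. -/
def sibuya (α : ℝ) (j : ℕ) : ℝ := Ring.choose α j * (-1) ^ (j + 1)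

end

/-!
The sum over partitions with all blocks of size at least `r` is a coefficient of a power series.
Let `F(z) = ∑_{j ≥ r} p_α(j) z ^ j` be the generating function of the upper part of Sibuya's
distribution. By the exponential formula (`sum_finpartition_eq_partitionCoeff`), the partitions of
an `l`-element set into blocks of size at least `r`, weighted by `(α y)_{k;α} ∏ (1 - α)_{|A| - 1}`
with `k` the number of blocks, have total weight `l! U_y(l)`, where `U_y(l)` is the
coefficient of `z ^ l` in `(1 - F(z)) ^ (-y)`. Splitting off the block of one element of `[m + 1]`
gives (`probSmallestGE_succ`)
`P(|A_{(K)}| ≥ r) = m! / (θ + 1)_m * ∑_{i + l = m, i + 1 ≥ r} β_i U_y(l)`, with `y = θ / α + 1` and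
`β_i = (1 - α)_i / i!`, the tail of Sibuya's distribution. This form needs no special treatment
of `θ = 0`, and all its terms are nonnegative because `y > 0`.

In this sum the block of the chosen element is typically the only large one. The coefficients
`U_y(l)` sum to `(1 - F(1)) ^ (-y)` and `1 - F(1) = ∑_{j < r} p_α(j)`; the numbers `β_{m - l} / β_m`
tend to `1` for each fixed `l`, and the condition `m - l + 1 ≥ r` holds for large `m` because
`r = o(m)`. Hence the sum, divided by `β_m`, is asymptotic to
`(∑_{j < r} p_α(j)) ^ (-1 - θ / α)` as soon as the `U_y(l)` are dominated by a summable sequence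
independent of `r`. Such a bound is `U_y(l) = O(β_l / (l + 1))` (`exists_partitionCoeff_le`). It
comes from using twice the differential equation of `(1 - F) ^ (-y)`, which is the recursion
`(m + 1) U_y(m + 1) = α y ∑_{i + l = m, i + 1 ≥ r} β_i U_{y + 1}(l)`: bounding `β_i` by `1` gives
`U_y(l) = O(1 / (l + 1))` for every `y > 0`, and inserting this bound into the half of the
convolution where `l` exceeds `i` gives the stronger one. The hypothesis `r ≥ 2` makes the
constants uniform, since `1 - F(1) ≥ α` then.

What remains is `β_m m! / (θ + 1)_m = (1 - α)_m / (1 + θ)_m`, whose asymptotics follow from Euler's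
limit formula for the Gamma function (`tendsto_risingStep_div_mul_rpow`).
-/

noncomputable section

/-! ### Decomposing a set partition by the block of a given element -/

/-- Adjoining the block `insert x B` to a partition of `t \ B` gives a partition of `insert x t`. -/
theorem insert_block_cover {ι : Type*} [DecidableEq ι] {x : ι} {t B : Finset ι} (hB : B ⊆ t) :
    t \ B ⊔ insert x B = insert x t := by
  rw [Finset.sup_eq_union, Finset.union_insert, Finset.sdiff_union_of_subset hB]

theorem insert_block_disjoint {ι : Type*} [DecidableEq ι] {x : ι} {t B : Finset ι} (hx : x ∉ t) :
    Disjoint (t \ B) (insert x B) := by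
  rw [Finset.disjoint_insert_right]
  exact ⟨fun h => hx (Finset.sdiff_subset h), Finset.sdiff_disjoint⟩

theorem Finpartition.exists_parts_eq_erase {ι : Type*} [DecidableEq ι] {s A : Finset ι}
    (P : Finpartition s) (hA : A ∈ P.parts) :
    ∃ Q : Finpartition (s \ A), Q.parts = P.parts.erase A := by
  refine ⟨P.ofSubset (parts := P.parts.erase A) (Finset.erase_subset _ _) ?_, rfl⟩
  ext i
  simp only [Finset.mem_sup, Finset.mem_erase, id_eq, Finset.mem_sdiff]
  constructor
  · rintro ⟨C, ⟨hCA, hC⟩, hi⟩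
    exact ⟨P.subset hC hi, fun hiA => hCA (P.eq_of_mem_parts hC hA hi hiA)⟩
  · rintro ⟨hi, hiA⟩
    obtain ⟨C, hC, hiC⟩ := P.exists_mem hi
    exact ⟨C, ⟨fun h => hiA (h ▸ hiC), hC⟩, hiC⟩

/-- A partition of `insert x t` amounts to the block `insert x B` of `x` and a partition
of `t \ B`. -/
theorem sum_finpartition_insert {ι M : Type*} [DecidableEq ι] [AddCommMonoid M] {x : ι}
    {t : Finset ι} (hx : x ∉ t) (f : Finset (Finset ι) → M) :
    ∑ π : Finpartition (insert x t), f π.parts =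
      ∑ B ∈ t.powerset, ∑ σ : Finpartition (t \ B), f (insert (insert x B) σ.parts) := by
  rw [Finset.sum_sigma']
  symm
  have hxs : ∀ {B : Finset ι} (σ : Finpartition (t \ B)) {C : Finset ι}, C ∈ σ.parts → x ∉ C :=
    fun σ C hC h => hx (Finset.sdiff_subset (σ.subset hC h))
  refine Finset.sum_bij (fun p hp => p.2.extend (Finset.insert_ne_empty x p.1)
    (insert_block_disjoint hx)
    (insert_block_cover (Finset.mem_powerset.1 (Finset.mem_sigma.1 hp).1))) ?_ ?_ ?_ ?_
  · intro p hp
    exact Finset.mem_univ _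
  · rintro ⟨B, σ⟩ hp ⟨B', σ'⟩ hp' h
    have hB : B ⊆ t := Finset.mem_powerset.1 (Finset.mem_sigma.1 hp).1
    have hB' : B' ⊆ t := Finset.mem_powerset.1 (Finset.mem_sigma.1 hp').1
    have hparts : insert (insert x B) σ.parts = insert (insert x B') σ'.parts :=
      congrArg Finpartition.parts h
    have h1 : insert x B = insert x B' := by
      have : insert x B ∈ insert (insert x B') σ'.parts := hparts ▸ Finset.mem_insert_self _ _
      rcases Finset.mem_insert.1 this with h | h
      · exact h
      · exact absurd (Finset.mem_insert_self x B) (hxs σ' h)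
    have h2 : B = B' := by
      rw [← Finset.erase_insert (fun h => hx (hB h)), h1,
        Finset.erase_insert (fun h => hx (hB' h))]
    subst h2
    have h3 : σ = σ' := by
      ext1
      rw [← Finset.erase_insert (fun h => hxs σ h (Finset.mem_insert_self x B)), hparts,
        Finset.erase_insert (fun h => hxs σ' h (Finset.mem_insert_self x B))]
    rw [h3]
  · intro π _
    have hA : π.part x ∈ π.parts := π.part_mem.2 (Finset.mem_insert_self x t)
    have hxA : x ∈ π.part x := π.mem_part (Finset.mem_insert_self x t)
    obtain ⟨Q, hQ⟩ := π.exists_parts_eq_erase hA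
    have hins : insert x ((π.part x).erase x) = π.part x := Finset.insert_erase hxA
    have hsub : (π.part x).erase x ⊆ t := by
      intro i hi
      rw [Finset.mem_erase] at hi
      exact Finset.mem_of_mem_insert_of_ne (π.subset hA hi.2) hi.1
    have hs : insert x t \ π.part x = t \ (π.part x).erase x := by
      ext i
      by_cases h : i = x <;> simp [h, hx, hxA]
    refine ⟨⟨(π.part x).erase x, Q.copy hs⟩, by simpa using hsub, ?_⟩
    ext1
    simp only [Finpartition.extend_parts, Finpartition.copy_parts, hins, hQ]
    exact Finset.insert_erase hA
  · intro p hp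
    rfl

/-- Splitting off the block of `x` in a sum of product form, in which the weight of a block
depends only on its size. -/
theorem sum_finpartition_insert_weight {ι : Type*} [DecidableEq ι] {x : ι} {t : Finset ι}
    (hx : x ∉ t) (g W : ℕ → ℝ) :
    ∑ π : Finpartition (insert x t), g π.parts.card * ∏ A ∈ π.parts, W A.card =
      ∑ B ∈ t.powerset, W (B.card + 1) *
        ∑ σ : Finpartition (t \ B), g (σ.parts.card + 1) * ∏ A ∈ σ.parts, W A.card := by
  rw [sum_finpartition_insert hx (fun P => g P.card * ∏ A ∈ P, W A.card)]
  refine Finset.sum_congr rfl fun B hB => ?_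
  rw [Finset.mul_sum]
  refine Finset.sum_congr rfl fun σ _ => ?_
  have h : insert x B ∉ σ.parts := fun h =>
    hx (Finset.sdiff_subset (σ.subset h (Finset.mem_insert_self x B)))
  rw [Finset.card_insert_of_notMem h, Finset.prod_insert h,
    Finset.card_insert_of_notMem fun h => hx (Finset.mem_powerset.1 hB h)]
  ring

/-! ### The coefficients of negative binomial series -/

/-- The coefficient `(y)_k / k!` of `z ^ k` in `(1 - z) ^ (-y)`. -/
def risingCoeff (y : ℝ) (k : ℕ) : ℝ := risingStep y 1 k / k.factorial

theorem risingStep_succ (x a : ℝ) (k : ℕ) :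
    risingStep x a (k + 1) = risingStep x a k * (x + k * a) := by
  simp [risingStep, Finset.prod_range_succ]

theorem risingStep_succ' (x a : ℝ) (k : ℕ) :
    risingStep x a (k + 1) = x * risingStep (x + a) a k :=
  risingStep_pred x a (Nat.succ_pos k)

theorem risingStep_pos {x a : ℝ} (hx : 0 < x) (ha : 0 ≤ a) (k : ℕ) : 0 < risingStep x a k :=
  Finset.prod_pos fun _ _ => by positivity

@[simp] theorem risingCoeff_zero (y : ℝ) : risingCoeff y 0 = 1 := by
  simp [risingCoeff, risingStep]

theorem succ_mul_risingCoeff_succ (y : ℝ) (k : ℕ) :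
    ((k : ℝ) + 1) * risingCoeff y (k + 1) = risingCoeff y k * (y + k) := by
  have h : (k.factorial : ℝ) ≠ 0 := by positivity
  rw [risingCoeff, risingCoeff, risingStep_succ, Nat.factorial_succ]
  push_cast
  field_simp

theorem succ_mul_risingCoeff_succ' (y : ℝ) (k : ℕ) :
    ((k : ℝ) + 1) * risingCoeff y (k + 1) = y * risingCoeff (y + 1) k := by
  have h : (k.factorial : ℝ) ≠ 0 := by positivity
  rw [risingCoeff, risingCoeff, risingStep_succ', Nat.factorial_succ]
  push_cast
  field_simp

theorem risingCoeff_pos {y : ℝ} (hy : 0 < y) (k : ℕ) : 0 < risingCoeff y k :=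
  div_pos (risingStep_pos hy zero_le_one k) (by positivity)

theorem risingCoeff_eq_multichoose (y : ℝ) (k : ℕ) : risingCoeff y k = Ring.multichoose y k := by
  have h : (k.factorial : ℝ) ≠ 0 := by positivity
  have h1 := Ring.factorial_nsmul_multichoose_eq_ascPochhammer y k
  rw [nsmul_eq_mul, Polynomial.ascPochhammer_smeval_eq_eval] at h1
  have h2 : ∀ k : ℕ, (ascPochhammer ℝ k).eval y = risingStep y 1 k := by
    intro k
    induction k with
    | zero => simp [risingStep]
    | succ k ih => rw [ascPochhammer_succ_eval, ih, risingStep_succ, mul_one]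
  rw [risingCoeff, ← h2, ← h1]
  field_simp

theorem hasSum_risingCoeff_mul_pow (y : ℝ) {q : ℝ} (hq0 : 0 ≤ q) (hq1 : q < 1) :
    HasSum (fun k => risingCoeff y k * q ^ k) ((1 - q) ^ (-y)) := by
  have h := (Real.one_div_one_sub_rpow_hasFPowerSeriesOnBall_zero y).hasSum (y := q)
    (by simpa [Metric.mem_eball, edist_dist, Real.dist_eq, abs_of_nonneg hq0] using hq1)
  rw [zero_add, one_div, ← Real.rpow_neg (by linarith)] at h
  refine h.congr_fun fun k => ?_
  rw [FormalMultilinearSeries.ofScalars_apply_eq, smul_eq_mul, risingCoeff_eq_multichoose,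
    Ring.multichoose_eq]

theorem sum_range_risingCoeff (y : ℝ) (m : ℕ) :
    ∑ i ∈ Finset.range (m + 1), risingCoeff y i = risingCoeff (y + 1) m := by
  induction m with
  | zero => simp
  | succ m ih =>
    rw [Finset.sum_range_succ, ih]
    simp only [risingCoeff_eq_multichoose]
    rw [Ring.multichoose_succ_succ, add_comm]

/-- Ratios of rising factorials grow like a power, by Euler's limit formula for `Γ`. -/
theorem tendsto_risingStep_div_mul_rpow {s t : ℝ} (hs : 0 < s) (ht : 0 < t) :
    Tendsto (fun m : ℕ => risingStep s 1 m / risingStep t 1 m * ((m + 1 : ℕ) : ℝ) ^ (t - s)) atTop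
      (nhds (Real.Gamma t / Real.Gamma s)) := by
  have h1 : Tendsto (fun m : ℕ => Real.GammaSeq t (m + 1) / Real.GammaSeq s (m + 1)) atTop
      (nhds (Real.Gamma t / Real.Gamma s)) :=
    (((Real.GammaSeq_tendsto_Gamma t).div (Real.GammaSeq_tendsto_Gamma s)
      (Real.Gamma_pos_of_pos hs).ne').comp (tendsto_add_atTop_nat 1))
  have hratio : ∀ c d : ℝ, Tendsto (fun m : ℕ => ((m : ℝ) + c) / ((m : ℝ) + d)) atTop (nhds 1) := by
    intro c d
    have hd : Tendsto (fun m : ℕ => (m : ℝ) + d) atTop atTop :=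
      tendsto_atTop_add_const_right _ _ tendsto_natCast_atTop_atTop
    have h : Tendsto (fun m : ℕ => 1 + (c - d) / ((m : ℝ) + d)) atTop (nhds (1 + 0)) :=
      tendsto_const_nhds.add (hd.const_div_atTop _)
    rw [add_zero] at h
    refine h.congr' ?_
    filter_upwards [hd.eventually_gt_atTop 0] with m hm
    field_simp
    ring
  have h2 := (h1.mul (hratio t s)).mul (hratio (t + 1) (s + 1))
  rw [mul_one, mul_one] at h2
  refine h2.congr fun m => ?_
  have hS := (risingStep_pos hs zero_le_one m).ne'
  have hT := (risingStep_pos ht zero_le_one m).ne'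
  have hm : (0 : ℝ) < ((m + 1 : ℕ) : ℝ) := by positivity
  have hprod : ∀ x : ℝ, ∏ j ∈ Finset.range (m + 1 + 1), (x + (j : ℝ)) =
      risingStep x 1 m * (x + m) * (x + (m + 1)) := by
    intro x
    rw [Finset.prod_range_succ, Finset.prod_range_succ]
    simp [risingStep]
  rw [Real.GammaSeq, Real.GammaSeq, hprod, hprod, Real.rpow_sub hm]
  have hms : ((m + 1 : ℕ) : ℝ) ^ s ≠ 0 := (Real.rpow_pos_of_pos hm s).ne'
  have hf : (((m + 1).factorial : ℕ) : ℝ) ≠ 0 := by positivity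
  have e1 : s + m ≠ 0 := by positivity
  have e2 : t + m ≠ 0 := by positivity
  have e3 : s + (m + 1) ≠ 0 := by positivity
  have e4 : t + (m + 1) ≠ 0 := by positivity
  rw [add_comm (m : ℝ) t, add_comm (m : ℝ) s, show (m : ℝ) + (t + 1) = t + (m + 1) by ring,
    show (m : ℝ) + (s + 1) = s + (m + 1) by ring]
  field_simp

theorem risingStep_one_one (m : ℕ) : risingStep 1 1 m = m.factorial := by
  induction m with
  | zero => simp [risingStep]
  | succ m ih => rw [risingStep_succ, ih, Nat.factorial_succ]; push_cast; ring

/-! ### Tails of Sibuya's distribution -/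

/-- The numbers `(1 - α)_i / i!` are the tails of Sibuya's distribution: `p_α(i + 1)` is the
difference of two consecutive ones. -/
theorem risingCoeff_sub_succ (α : ℝ) (i : ℕ) :
    risingCoeff (1 - α) i - risingCoeff (1 - α) (i + 1) =
      α / ((i : ℝ) + 1) * risingCoeff (1 - α) i := by
  have h := succ_mul_risingCoeff_succ (1 - α) i
  have hi : (i : ℝ) + 1 ≠ 0 := by positivity
  field_simp
  linarith

theorem sibuya_succ (α : ℝ) (i : ℕ) :
    sibuya α (i + 1) = α / ((i : ℝ) + 1) * risingCoeff (1 - α) i := by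
  have h1 : risingCoeff (-α) (i + 1) = (-1) ^ (i + 1) * Ring.choose α (i + 1) := by
    have h := Ring.choose_neg (-α) (i + 1)
    rw [neg_neg] at h
    rw [h, risingCoeff_eq_multichoose, Ring.multichoose_eq, Units.smul_def, zsmul_eq_mul,
      Int.coe_negOnePow_natCast, Int.cast_pow, Int.cast_neg, Int.cast_one, ← mul_assoc, ← mul_pow,
      neg_one_mul, neg_neg, one_pow, one_mul]
  have h2 := succ_mul_risingCoeff_succ' (-α) i
  have hi : (i : ℝ) + 1 ≠ 0 := by positivity
  rw [h1, neg_add_eq_sub] at h2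
  rw [sibuya, pow_succ _ (i + 1)]
  field_simp
  linarith

theorem sum_sibuya (α : ℝ) (i : ℕ) :
    ∑ j ∈ Finset.Icc 1 i, sibuya α j = 1 - risingCoeff (1 - α) i := by
  induction i with
  | zero => simp
  | succ i ih =>
    rw [Finset.sum_Icc_succ_top (by omega), ih, sibuya_succ, ← risingCoeff_sub_succ]
    ring

theorem antitone_risingCoeff {α : ℝ} (hα0 : 0 < α) (hα1 : α < 1) :
    Antitone (risingCoeff (1 - α)) := by
  refine antitone_nat_of_succ_le fun i => ?_
  have h := risingCoeff_sub_succ α i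
  have := (risingCoeff_pos (sub_pos.2 hα1) i).le
  have : 0 ≤ α / ((i : ℝ) + 1) * risingCoeff (1 - α) i := by positivity
  linarith

theorem tendsto_risingCoeff_zero {α : ℝ} (hα0 : 0 < α) (hα1 : α < 1) :
    Tendsto (risingCoeff (1 - α)) atTop (nhds 0) := by
  have h1 := tendsto_risingStep_div_mul_rpow (sub_pos.2 hα1) one_pos
  have h2 : Tendsto (fun m : ℕ => ((m + 1 : ℕ) : ℝ) ^ (-α)) atTop (nhds 0) :=
    (tendsto_rpow_neg_atTop hα0).comp (tendsto_natCast_atTop_atTop.comp (tendsto_add_atTop_nat 1))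
  have h3 := h1.mul h2
  rw [mul_zero] at h3
  refine h3.congr fun m => ?_
  have hm : (0 : ℝ) < ((m + 1 : ℕ) : ℝ) := by positivity
  rw [mul_assoc, ← Real.rpow_add hm, risingStep_one_one, risingCoeff]
  simp

theorem mul_sum_range_risingCoeff (α : ℝ) (m : ℕ) :
    (1 - α) * ∑ i ∈ Finset.range (m + 1), risingCoeff (1 - α) i =
      risingCoeff (1 - α) m * (m + 1 - α) := by
  rw [sum_range_risingCoeff, ← succ_mul_risingCoeff_succ', succ_mul_risingCoeff_succ]
  ring

theorem hasSum_risingCoeff_tail {α : ℝ} (hα0 : 0 < α) (hα1 : α < 1) (r : ℕ) :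
    HasSum (fun i : ℕ => if r ≤ i then α / ((i : ℝ) + 1) * risingCoeff (1 - α) i else 0)
      (risingCoeff (1 - α) r) := by
  have hnn : ∀ i : ℕ, 0 ≤ α / ((i : ℝ) + 1) * risingCoeff (1 - α) i := fun i => by
    have := (risingCoeff_pos (sub_pos.2 hα1) i).le
    positivity
  rw [hasSum_iff_tendsto_nat_of_nonneg fun i => by split_ifs; exacts [hnn i, le_rfl]]
  have h1 : Tendsto (fun n => risingCoeff (1 - α) r - risingCoeff (1 - α) n) atTop
      (nhds (risingCoeff (1 - α) r - 0)) :=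
    tendsto_const_nhds.sub (tendsto_risingCoeff_zero hα0 hα1)
  rw [sub_zero] at h1
  refine h1.congr' ?_
  filter_upwards [eventually_ge_atTop r] with n hn
  induction n, hn using Nat.le_induction with
  | base =>
    rw [sub_self, Finset.sum_eq_zero]
    intro i hi
    rw [if_neg (by simpa using hi)]
  | succ n hn ih =>
    rw [Finset.sum_range_succ, ← ih, if_pos hn, ← risingCoeff_sub_succ]
    ring

/-! ### The exponential generating function of the restricted partition weights -/

/-- The weight `(1 - α)_i / i!` of a block of size `i + 1`, set to zero if the block has fewer
than `r` elements. -/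
def blockWeight (α : ℝ) (r i : ℕ) : ℝ := if r ≤ i + 1 then risingCoeff (1 - α) i else 0

/-- The power series `∑_{j ≥ r} p_α(j) z ^ j`. The coefficient at `j = 0` is `0`, as the division
by `j` there has the value `0`. -/
def blockSeries (α : ℝ) (r : ℕ) : PowerSeries ℝ :=
  PowerSeries.mk fun j => α / j * blockWeight α r (j - 1)

/-- The coefficient of `z ^ m` in `(1 - F(z)) ^ (-y)`, where `F = blockSeries α r`. It is written
as a finite sum, since `F ^ k` has no terms of degree less than `k`. -/
def partitionCoeff (α : ℝ) (r : ℕ) (y : ℝ) (m : ℕ) : ℝ :=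
  ∑ k ∈ Finset.range (m + 1), risingCoeff y k * PowerSeries.coeff m (blockSeries α r ^ k)

theorem coeff_succ_blockSeries (α : ℝ) (r i : ℕ) :
    PowerSeries.coeff (i + 1) (blockSeries α r) = α / ((i : ℝ) + 1) * blockWeight α r i := by
  simp [blockSeries]

theorem constantCoeff_blockSeries (α : ℝ) (r : ℕ) :
    PowerSeries.constantCoeff (blockSeries α r) = 0 := by
  rw [← PowerSeries.coeff_zero_eq_constantCoeff_apply]
  simp [blockSeries]

theorem coeff_blockSeries_pow_of_lt (α : ℝ) (r : ℕ) {m k : ℕ} (h : m < k) :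
    PowerSeries.coeff m (blockSeries α r ^ k) = 0 :=
  PowerSeries.coeff_of_lt_order _ (lt_of_lt_of_le (by exact_mod_cast h)
    (PowerSeries.le_order_pow_of_constantCoeff_eq_zero k (constantCoeff_blockSeries α r)))

theorem partitionCoeff_eq_sum (α : ℝ) (r : ℕ) (y : ℝ) {m N : ℕ} (h : m < N) :
    partitionCoeff α r y m =
      ∑ k ∈ Finset.range N, risingCoeff y k * PowerSeries.coeff m (blockSeries α r ^ k) := by
  refine Finset.sum_subset (fun k hk => ?_) fun k _ hk => ?_
  · simp only [Finset.mem_range] at hk ⊢; omega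
  · rw [coeff_blockSeries_pow_of_lt α r (by simpa using hk), mul_zero]

@[simp] theorem partitionCoeff_zero (α : ℝ) (r : ℕ) (y : ℝ) : partitionCoeff α r y 0 = 1 := by
  simp [partitionCoeff]

theorem derivative_blockSeries (α : ℝ) (r : ℕ) :
    PowerSeries.derivative ℝ (blockSeries α r) = α • PowerSeries.mk (blockWeight α r) := by
  ext i
  rw [PowerSeries.coeff_derivative, coeff_succ_blockSeries, map_smul, PowerSeries.coeff_mk,
    smul_eq_mul]
  have hi : (i : ℝ) + 1 ≠ 0 := by positivity
  field_simp

theorem succ_mul_coeff_blockSeries_pow (α : ℝ) (r m k : ℕ) :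
    ((m : ℝ) + 1) * PowerSeries.coeff (m + 1) (blockSeries α r ^ (k + 1)) =
      ((k : ℝ) + 1) * (α * ∑ p ∈ Finset.HasAntidiagonal.antidiagonal m,
        blockWeight α r p.1 * PowerSeries.coeff p.2 (blockSeries α r ^ k)) := by
  have h : PowerSeries.derivative ℝ (blockSeries α r ^ (k + 1)) =
      ((k : ℝ) + 1) • α • (PowerSeries.mk (blockWeight α r) * blockSeries α r ^ k) := by
    rw [Derivation.leibniz_pow, derivative_blockSeries, Nat.add_sub_cancel, smul_eq_mul,
      mul_smul_comm, mul_comm, ← Nat.cast_smul_eq_nsmul ℝ]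
    push_cast
    rfl
  rw [mul_comm, ← PowerSeries.coeff_derivative, h, map_smul, map_smul, PowerSeries.coeff_mul]
  simp

/-- Comparison of coefficients in `G' = α y W (1 - F) ^ (-y - 1)` for `G = (1 - F) ^ (-y)`,
with `F' = α W`. -/
theorem succ_mul_partitionCoeff_succ (α : ℝ) (r : ℕ) (y : ℝ) (m : ℕ) :
    ((m : ℝ) + 1) * partitionCoeff α r y (m + 1) =
      α * y * ∑ p ∈ Finset.HasAntidiagonal.antidiagonal m,
        blockWeight α r p.1 * partitionCoeff α r (y + 1) p.2 := by
  have h1 : ∀ p ∈ Finset.HasAntidiagonal.antidiagonal m,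
      blockWeight α r p.1 * partitionCoeff α r (y + 1) p.2 =
        ∑ k ∈ Finset.range (m + 1), risingCoeff (y + 1) k *
          (blockWeight α r p.1 * PowerSeries.coeff p.2 (blockSeries α r ^ k)) := by
    intro p hp
    rw [partitionCoeff_eq_sum α r (y + 1)
      (by have := Finset.HasAntidiagonal.mem_antidiagonal.1 hp; omega : p.2 < m + 1), Finset.mul_sum]
    exact Finset.sum_congr rfl fun k _ => by ring
  rw [Finset.sum_congr rfl h1, Finset.sum_comm, partitionCoeff, Finset.sum_range_succ', pow_zero,
    PowerSeries.coeff_one, if_neg (Nat.succ_ne_zero m), mul_zero, add_zero, Finset.mul_sum,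
    Finset.mul_sum]
  refine Finset.sum_congr rfl fun k _ => ?_
  rw [← Finset.mul_sum, mul_left_comm, succ_mul_coeff_blockSeries_pow, ← mul_assoc,
    mul_comm (risingCoeff y (k + 1)), succ_mul_risingCoeff_succ']
  ring

/-! ### Restricted partition sums as coefficients -/

/-- The weight `(1 - α)_{a - 1}` of a block of size `a`, set to zero if `a < r`. -/
def sizeWeight (α : ℝ) (r a : ℕ) : ℝ := if r ≤ a then risingStep (1 - α) 1 (a - 1) else 0

theorem sizeWeight_succ (α : ℝ) (r b : ℕ) :
    sizeWeight α r (b + 1) = b.factorial * blockWeight α r b := by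
  have h : (b.factorial : ℝ) ≠ 0 := by positivity
  rw [sizeWeight, blockWeight, Nat.add_sub_cancel]
  split_ifs
  · rw [risingCoeff]; field_simp
  · simp

theorem sum_powerset_sizeWeight {ι : Type*} [DecidableEq ι] (α : ℝ) (r : ℕ) (t : Finset ι)
    (V : ℕ → ℝ) :
    ∑ B ∈ t.powerset, sizeWeight α r (B.card + 1) *
        ((t \ B).card.factorial * V (t \ B).card) =
      t.card.factorial * ∑ p ∈ Finset.HasAntidiagonal.antidiagonal t.card, blockWeight α r p.1 * V p.2 := by
  have h1 : ∀ B ∈ t.powerset, sizeWeight α r (B.card + 1) *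
        ((t \ B).card.factorial * V (t \ B).card) =
      (fun b => b.factorial * blockWeight α r b *
        ((t.card - b).factorial * V (t.card - b))) B.card := by
    intro B hB
    rw [Finset.card_sdiff_of_subset (Finset.mem_powerset.1 hB), sizeWeight_succ]
  rw [Finset.sum_congr rfl h1, Finset.sum_powerset_apply_card (fun b : ℕ =>
      (b.factorial : ℝ) * blockWeight α r b * ((t.card - b).factorial * V (t.card - b))),
    Finset.Nat.sum_antidiagonal_eq_sum_range_succ_mk, Finset.mul_sum]
  refine Finset.sum_congr rfl fun b hb => ?_
  rw [nsmul_eq_mul, ← Nat.choose_mul_factorial_mul_factorial (Nat.lt_succ_iff.1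
    (Finset.mem_range.1 hb))]
  push_cast
  ring

/-- The exponential formula for set partitions all of whose blocks have at least `r` elements. -/
theorem sum_finpartition_eq_partitionCoeff {ι : Type*} [DecidableEq ι] (α : ℝ) (r : ℕ) (y : ℝ)
    (s : Finset ι) :
    ∑ π : Finpartition s, risingStep (α * y) α π.parts.card *
        ∏ A ∈ π.parts, sizeWeight α r A.card =
      s.card.factorial * partitionCoeff α r y s.card := by
  induction hn : s.card using Nat.strong_induction_on generalizing s y with
  | _ n ih =>
  rcases s.eq_empty_or_nonempty with rfl | ⟨x, hx⟩
  · subst hn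
    have : ∀ π : Finpartition (∅ : Finset ι), π.parts = ∅ := fun π =>
      Finpartition.parts_eq_empty_iff.2 rfl
    have hcard : Fintype.card (Finpartition (∅ : Finset ι)) = 1 :=
      Fintype.card_eq_one_iff.2 ⟨Finpartition.empty _, fun π => by ext1; rw [this, this]⟩
    simp [this, hcard, risingStep]
  · obtain ⟨t, hxt, rfl⟩ : ∃ t, x ∉ t ∧ insert x t = s :=
      ⟨s.erase x, Finset.notMem_erase x s, Finset.insert_erase hx⟩
    rw [Finset.card_insert_of_notMem hxt] at hn
    subst hn
    rw [sum_finpartition_insert_weight hxt (risingStep (α * y) α)]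
    have h1 : ∀ B ∈ t.powerset, sizeWeight α r (B.card + 1) *
          ∑ σ : Finpartition (t \ B), risingStep (α * y) α (σ.parts.card + 1) *
            ∏ A ∈ σ.parts, sizeWeight α r A.card =
        α * y * (sizeWeight α r (B.card + 1) *
          ((t \ B).card.factorial * partitionCoeff α r (y + 1) (t \ B).card)) := by
      intro B hB
      rw [← ih _ (Nat.lt_succ_of_le (Finset.card_le_card Finset.sdiff_subset)) (y + 1) (t \ B) rfl,
        mul_left_comm, Finset.mul_sum _ _ (α * y)]
      simp_rw [risingStep_succ', mul_assoc, mul_add, mul_one]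
    rw [Finset.sum_congr rfl h1, ← Finset.mul_sum, sum_powerset_sizeWeight, mul_left_comm,
      ← succ_mul_partitionCoeff_succ, Nat.factorial_succ]
    push_cast
    ring

/-- The probability that all blocks have at least `r` elements, obtained by conditioning on the
block of one element. -/
theorem probSmallestGE_succ {α θ : ℝ} (hα0 : 0 < α) (hα1 : α < 1) (hθ : -α < θ) (m r : ℕ) :
    probSmallestGE α θ (m + 1) r =
      m.factorial / risingStep (θ + 1) 1 m *
        ∑ p ∈ Finset.HasAntidiagonal.antidiagonal m,
          blockWeight α r p.1 * partitionCoeff α r (θ / α + 1) p.2 := by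
  classical
  have hnn : ∀ π : SetPartition (m + 1), 0 ≤ ewensPitmanEPPF α θ (m + 1) π := fun π =>
    mul_nonneg (div_nonneg (risingStep_pos (by linarith) hα0.le _).le
      (risingStep_pos (by linarith) zero_le_one _).le)
      (Finset.prod_nonneg fun A _ => (risingStep_pos (by linarith) zero_le_one _).le)
  have hmem : ∀ π : SetPartition (m + 1), r ≤ smallestSize π ↔ ∀ A ∈ π.parts, r ≤ A.card := by
    intro π
    obtain ⟨A, hA⟩ := π.parts_nonempty (Finset.univ_nonempty (α := Fin (m + 1))).ne_empty
    have hne : {a | ∃ A ∈ π.parts, A.card = a}.Nonempty := ⟨A.card, A, hA, rfl⟩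
    rw [smallestSize, le_csInf_iff'' hne]
    exact ⟨fun h A hA => h _ ⟨A, hA, rfl⟩, by rintro h _ ⟨A, hA, rfl⟩; exact h A hA⟩
  have h1 : probSmallestGE α θ (m + 1) r = ∑ π : SetPartition (m + 1),
      risingStep (θ + α) α (π.parts.card - 1) / risingStep (θ + 1) 1 m *
        ∏ A ∈ π.parts, sizeWeight α r A.card := by
    rw [probSmallestGE, ewensPitman, Measure.real, Measure.finsetSum_apply,
      ENNReal.toReal_sum fun π _ => by
        rw [Measure.smul_apply, smul_eq_mul]
        exact ENNReal.mul_ne_top ENNReal.ofReal_ne_top (measure_ne_top _ _)]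
    refine Finset.sum_congr rfl fun π _ => ?_
    rw [Measure.smul_apply, Measure.dirac_apply' _ MeasurableSpace.measurableSet_top, smul_eq_mul, ENNReal.toReal_mul,
      ENNReal.toReal_ofReal (hnn π), Set.indicator_apply]
    split_ifs with h
    · replace h := (hmem π).1 h
      rw [Pi.one_apply, ENNReal.toReal_one, mul_one, ewensPitmanEPPF, Nat.add_sub_cancel]
      congr 1
      exact Finset.prod_congr rfl fun A hA => by rw [sizeWeight, if_pos (h A hA)]
    · replace h : ¬ ∀ A ∈ π.parts, r ≤ A.card := fun h' => h ((hmem π).2 h')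
      push Not at h
      obtain ⟨A, hA, hAr⟩ := h
      rw [Finset.prod_eq_zero hA (by rw [sizeWeight, if_neg (by omega)])]
      simp
  have h2 : ∀ s : Finset (Fin (m + 1)), s.card = m + 1 → ∑ π : Finpartition s,
      risingStep (θ + α) α (π.parts.card - 1) / risingStep (θ + 1) 1 m *
        ∏ A ∈ π.parts, sizeWeight α r A.card =
      m.factorial / risingStep (θ + 1) 1 m * ∑ p ∈ Finset.HasAntidiagonal.antidiagonal m,
          blockWeight α r p.1 * partitionCoeff α r (θ / α + 1) p.2 := by
    intro s hs
    obtain ⟨x, hx⟩ : s.Nonempty := Finset.card_pos.1 (by omega)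
    obtain ⟨t, hxt, rfl⟩ : ∃ t, x ∉ t ∧ insert x t = s :=
      ⟨s.erase x, Finset.notMem_erase x s, Finset.insert_erase hx⟩
    rw [Finset.card_insert_of_notMem hxt, Nat.add_right_cancel_iff] at hs
    have hy : θ + α = α * (θ / α + 1) := by field_simp
    rw [sum_finpartition_insert_weight hxt
      (fun k => risingStep (θ + α) α (k - 1) / risingStep (θ + 1) 1 m)]
    simp_rw [Nat.add_sub_cancel, div_mul_eq_mul_div, ← Finset.sum_div, hy,
      sum_finpartition_eq_partitionCoeff, ← mul_div_assoc]
    rw [← Finset.sum_div, sum_powerset_sizeWeight, hs]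
  rw [h1]
  exact h2 Finset.univ (by simp)

/-! ### The total mass of the coefficients -/

theorem blockWeight_nonneg {α : ℝ} (hα1 : α < 1) (r i : ℕ) : 0 ≤ blockWeight α r i := by
  rw [blockWeight]
  split_ifs
  exacts [(risingCoeff_pos (sub_pos.2 hα1) i).le, le_rfl]

theorem blockWeight_le {α : ℝ} (hα1 : α < 1) (r i : ℕ) :
    blockWeight α r i ≤ risingCoeff (1 - α) i := by
  rw [blockWeight]
  split_ifs
  exacts [le_rfl, (risingCoeff_pos (sub_pos.2 hα1) i).le]

theorem coeff_blockSeries_nonneg {α : ℝ} (hα0 : 0 < α) (hα1 : α < 1) (r j : ℕ) :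
    0 ≤ PowerSeries.coeff j (blockSeries α r) := by
  rw [blockSeries, PowerSeries.coeff_mk]
  exact mul_nonneg (by positivity) (blockWeight_nonneg hα1 r _)

theorem coeff_blockSeries_pow_nonneg {α : ℝ} (hα0 : 0 < α) (hα1 : α < 1) (r m k : ℕ) :
    0 ≤ PowerSeries.coeff m (blockSeries α r ^ k) := by
  induction k generalizing m with
  | zero => rw [pow_zero, PowerSeries.coeff_one]; split_ifs <;> norm_num
  | succ k ih =>
    rw [pow_succ, PowerSeries.coeff_mul]
    exact Finset.sum_nonneg fun p _ => mul_nonneg (ih _) (coeff_blockSeries_nonneg hα0 hα1 r _)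

theorem partitionCoeff_nonneg {α : ℝ} (hα0 : 0 < α) (hα1 : α < 1) (r : ℕ) {y : ℝ} (hy : 0 < y)
    (m : ℕ) : 0 ≤ partitionCoeff α r y m :=
  Finset.sum_nonneg fun k _ =>
    mul_nonneg (risingCoeff_pos hy k).le (coeff_blockSeries_pow_nonneg hα0 hα1 r m k)

theorem hasSum_coeff_blockSeries {α : ℝ} (hα0 : 0 < α) (hα1 : α < 1) (r : ℕ) :
    HasSum (fun j => PowerSeries.coeff j (blockSeries α r)) (risingCoeff (1 - α) (r - 1)) := by
  rw [← hasSum_nat_add_iff' 1]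
  simp only [Finset.sum_range_one, PowerSeries.coeff_zero_eq_constantCoeff_apply,
    constantCoeff_blockSeries, sub_zero]
  refine (hasSum_risingCoeff_tail hα0 hα1 (r - 1)).congr_fun fun i => ?_
  rw [coeff_succ_blockSeries, blockWeight, mul_ite, mul_zero]
  exact if_congr (by omega) rfl rfl

theorem hasSum_coeff_blockSeries_pow {α : ℝ} (hα0 : 0 < α) (hα1 : α < 1) (r k : ℕ) :
    HasSum (fun m => PowerSeries.coeff m (blockSeries α r ^ k))
      (risingCoeff (1 - α) (r - 1) ^ k) := by
  induction k with
  | zero =>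
    simp only [pow_zero, PowerSeries.coeff_one]
    exact hasSum_ite_eq 0 1
  | succ k ih =>
    have h1 := hasSum_coeff_blockSeries hα0 hα1 r
    have n1 : Summable fun m => ‖PowerSeries.coeff m (blockSeries α r ^ k)‖ := ih.summable.norm
    have n2 : Summable fun m => ‖PowerSeries.coeff m (blockSeries α r)‖ := h1.summable.norm
    have h2 := tsum_mul_tsum_eq_tsum_sum_antidiagonal_of_summable_norm n1 n2
    rw [ih.tsum_eq, h1.tsum_eq] at h2
    rw [pow_succ (risingCoeff (1 - α) (r - 1)), h2]
    simp only [pow_succ, PowerSeries.coeff_mul]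
    exact (summable_norm_sum_mul_antidiagonal_of_summable_norm n1 n2).of_norm.hasSum

/-- The total mass is the value of `(1 - F(z)) ^ (-y)` at `z = 1`. -/
theorem hasSum_partitionCoeff {α : ℝ} (hα0 : 0 < α) (hα1 : α < 1) {r : ℕ} {y : ℝ} (hy : 0 < y)
    (hq : risingCoeff (1 - α) (r - 1) < 1) :
    HasSum (partitionCoeff α r y) ((1 - risingCoeff (1 - α) (r - 1)) ^ (-y)) := by
  set q := risingCoeff (1 - α) (r - 1) with hqdef
  have hq0 : 0 ≤ q := (risingCoeff_pos (sub_pos.2 hα1) _).le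
  have hb := hasSum_risingCoeff_mul_pow y hq0 hq
  let f : ℕ × ℕ → ℝ := fun p => risingCoeff y p.1 * PowerSeries.coeff p.2 (blockSeries α r ^ p.1)
  have hk : ∀ k, HasSum (fun m => f (k, m)) (risingCoeff y k * q ^ k) := fun k =>
    (hasSum_coeff_blockSeries_pow hα0 hα1 r k).mul_left _
  have hf : Summable f := by
    rw [summable_prod_of_nonneg fun p => mul_nonneg (risingCoeff_pos hy _).le
      (coeff_blockSeries_pow_nonneg hα0 hα1 r _ _)]
    exact ⟨fun k => (hk k).summable, hb.summable.congr fun k => (hk k).tsum_eq.symm⟩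
  have hsum : HasSum f ((1 - q) ^ (-y)) := by
    have h := hf.hasSum.prod_fiberwise hk
    rw [hb.unique h]
    exact hf.hasSum
  have hswap : HasSum (fun p : ℕ × ℕ => f p.swap) ((1 - q) ^ (-y)) :=
    (Equiv.prodComm ℕ ℕ).hasSum_iff.2 hsum
  refine hswap.prod_fiberwise fun m => ?_
  refine hasSum_sum_of_ne_finset_zero fun k hk => ?_
  simp only [f, Prod.swap_prod_mk]
  rw [coeff_blockSeries_pow_of_lt α r (by simpa using hk), mul_zero]

/-! ### Bounds that are uniform in the minimal block size -/

theorem risingCoeff_pred_le {α : ℝ} (hα0 : 0 < α) (hα1 : α < 1) {r : ℕ} (hr : 2 ≤ r) :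
    risingCoeff (1 - α) (r - 1) ≤ 1 - α := by
  have h : risingCoeff (1 - α) 1 = 1 - α := by simp [risingCoeff, risingStep]
  exact (antitone_risingCoeff hα0 hα1 (show 1 ≤ r - 1 by omega)).trans h.le

theorem sum_partitionCoeff_le {α : ℝ} (hα0 : 0 < α) (hα1 : α < 1) {r : ℕ} (hr : 2 ≤ r) {y : ℝ}
    (hy : 0 < y) (s : Finset ℕ) : ∑ l ∈ s, partitionCoeff α r y l ≤ α ^ (-y) := by
  have hq := risingCoeff_pred_le hα0 hα1 hr
  refine (sum_le_hasSum s (fun l _ => partitionCoeff_nonneg hα0 hα1 r hy l)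
    (hasSum_partitionCoeff hα0 hα1 hy (by linarith))).trans ?_
  exact Real.rpow_le_rpow_of_nonpos hα0 (by linarith) (by linarith)

theorem sum_antidiagonal_snd (f : ℕ → ℝ) (m : ℕ) :
    ∑ p ∈ Finset.HasAntidiagonal.antidiagonal m, f p.2 = ∑ l ∈ Finset.range (m + 1), f l := by
  rw [← Finset.Nat.sum_antidiagonal_swap]
  exact Finset.Nat.sum_antidiagonal_eq_sum_range_succ_mk (fun p => f p.1) m

theorem sum_antidiagonal_fst (f : ℕ → ℝ) (m : ℕ) :
    ∑ p ∈ Finset.HasAntidiagonal.antidiagonal m, f p.1 = ∑ l ∈ Finset.range (m + 1), f l :=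
  Finset.Nat.sum_antidiagonal_eq_sum_range_succ_mk (fun p => f p.1) m

theorem risingCoeff_le_of_le_two_mul {α : ℝ} (hα1 : α < 1) {i m : ℕ} (hα0 : 0 < α) (him : i ≤ m)
    (hm : m ≤ 2 * i) :
    risingCoeff (1 - α) i ≤ 2 / (1 - α) * risingCoeff (1 - α) m := by
  have h1 : 0 < 1 - α := sub_pos.2 hα1
  have hβ := risingCoeff_pos h1 i
  have hβm := risingCoeff_pos h1 m
  -- `β_i (i + 1 - α)` is, up to the factor `1 - α`, a partial sum of `β`, so it increases with `i`
  have h2 : risingCoeff (1 - α) i * (i + 1 - α) ≤ risingCoeff (1 - α) m * (m + 1 - α) := by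
    rw [← mul_sum_range_risingCoeff, ← mul_sum_range_risingCoeff]
    refine mul_le_mul_of_nonneg_left ?_ h1.le
    exact Finset.sum_le_sum_of_subset_of_nonneg (Finset.range_mono (by omega))
      fun k _ _ => (risingCoeff_pos h1 k).le
  have hm' : (m : ℝ) + 1 ≤ 2 * (i + 1) := by exact_mod_cast (by omega : m + 1 ≤ 2 * (i + 1))
  have hi : (0 : ℝ) ≤ i := by positivity
  have h3 : (1 - α) * (i + 1) ≤ i + 1 - α := by nlinarith
  have h4 : risingCoeff (1 - α) i * ((1 - α) * (i + 1)) ≤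
      risingCoeff (1 - α) m * (2 * (i + 1)) :=
    ((mul_le_mul_of_nonneg_left h3 hβ.le).trans h2).trans
      (mul_le_mul_of_nonneg_left (by linarith) hβm.le)
  have h5 : (risingCoeff (1 - α) i * (1 - α)) * (i + 1) ≤
      (2 * risingCoeff (1 - α) m) * (i + 1) := by linarith
  have h6 := le_of_mul_le_mul_right h5 (by positivity)
  rw [div_mul_eq_mul_div, le_div_iff₀ h1]
  exact h6

/-- The part of the convolution in which the block of size `p.1 + 1` is the large one. -/
theorem sum_near_le {α : ℝ} (hα0 : 0 < α) (hα1 : α < 1) {r : ℕ} (hr : 2 ≤ r) {y : ℝ}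
    (hy : 0 < y) (m : ℕ) :
    ∑ p ∈ Finset.HasAntidiagonal.antidiagonal m with p.2 ≤ p.1,
        blockWeight α r p.1 * partitionCoeff α r y p.2 ≤
      2 / (1 - α) * risingCoeff (1 - α) m * α ^ (-y) := by
  have h1 : 0 < 1 - α := sub_pos.2 hα1
  have hK : 0 ≤ 2 / (1 - α) * risingCoeff (1 - α) m :=
    mul_nonneg (by positivity) (risingCoeff_pos h1 m).le
  calc _ ≤ ∑ p ∈ Finset.HasAntidiagonal.antidiagonal m with p.2 ≤ p.1,
        2 / (1 - α) * risingCoeff (1 - α) m * partitionCoeff α r y p.2 := by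
        refine Finset.sum_le_sum fun p hp => ?_
        rw [Finset.mem_filter, Finset.HasAntidiagonal.mem_antidiagonal] at hp
        refine mul_le_mul_of_nonneg_right ?_ (partitionCoeff_nonneg hα0 hα1 r hy _)
        exact (blockWeight_le hα1 r _).trans
          (risingCoeff_le_of_le_two_mul hα1 hα0 (by omega) (by omega))
    _ ≤ ∑ p ∈ Finset.HasAntidiagonal.antidiagonal m,
        2 / (1 - α) * risingCoeff (1 - α) m * partitionCoeff α r y p.2 :=
        Finset.sum_le_sum_of_subset_of_nonneg (Finset.filter_subset _ _)
          fun p _ _ => mul_nonneg hK (partitionCoeff_nonneg hα0 hα1 r hy _)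
    _ ≤ _ := by
        rw [← Finset.mul_sum, sum_antidiagonal_snd]
        exact mul_le_mul_of_nonneg_left (sum_partitionCoeff_le hα0 hα1 hr hy _) hK

/-- The part of the convolution in which the block of size `p.1 + 1` is the small one. -/
theorem sum_far_le {α : ℝ} (hα0 : 0 < α) (hα1 : α < 1) (r m : ℕ) (V : ℕ → ℝ) {D : ℝ} (hD : 0 ≤ D)
    (hV : ∀ l ≤ m, m < 2 * l → V l ≤ D) :
    ∑ p ∈ Finset.HasAntidiagonal.antidiagonal m with ¬ p.2 ≤ p.1, blockWeight α r p.1 * V p.2 ≤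
      D * (risingCoeff (1 - α) m * (m + 1) / (1 - α)) := by
  have h1 : 0 < 1 - α := sub_pos.2 hα1
  calc _ ≤ ∑ p ∈ Finset.HasAntidiagonal.antidiagonal m with ¬ p.2 ≤ p.1,
        D * risingCoeff (1 - α) p.1 := by
        refine Finset.sum_le_sum fun p hp => ?_
        rw [Finset.mem_filter, Finset.HasAntidiagonal.mem_antidiagonal] at hp
        rw [mul_comm]
        exact mul_le_mul (hV _ (by omega) (by omega)) (blockWeight_le hα1 r _)
          (blockWeight_nonneg hα1 r _) hD
    _ ≤ ∑ p ∈ Finset.HasAntidiagonal.antidiagonal m, D * risingCoeff (1 - α) p.1 :=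
        Finset.sum_le_sum_of_subset_of_nonneg (Finset.filter_subset _ _)
          fun p _ _ => mul_nonneg hD (risingCoeff_pos h1 _).le
    _ ≤ _ := by
        rw [← Finset.mul_sum, sum_antidiagonal_fst]
        refine mul_le_mul_of_nonneg_left ?_ hD
        rw [le_div_iff₀ h1, mul_comm, mul_sum_range_risingCoeff]
        exact mul_le_mul_of_nonneg_left (by linarith) (risingCoeff_pos h1 m).le

theorem exists_succ_mul_partitionCoeff_le {α : ℝ} (hα0 : 0 < α) (hα1 : α < 1) {y : ℝ}
    (hy : 0 < y) :
    ∃ C : ℝ, 0 ≤ C ∧ ∀ r, 2 ≤ r → ∀ l : ℕ, ((l : ℝ) + 1) * partitionCoeff α r y l ≤ C := by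
  have h1 : 0 < 1 - α := sub_pos.2 hα1
  refine ⟨α * y * α ^ (-(y + 1)) + α ^ (-y), by positivity, fun r hr l => ?_⟩
  have hU : partitionCoeff α r y l ≤ α ^ (-y) := by
    simpa using sum_partitionCoeff_le hα0 hα1 hr hy {l}
  have hlU : (l : ℝ) * partitionCoeff α r y l ≤ α * y * α ^ (-(y + 1)) := by
    rcases l with _ | m
    · rw [Nat.cast_zero, zero_mul]; positivity
    · push_cast
      rw [succ_mul_partitionCoeff_succ]
      refine mul_le_mul_of_nonneg_left ?_ (by positivity)
      refine le_trans (Finset.sum_le_sum fun p _ => ?_)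
        ((sum_antidiagonal_snd (partitionCoeff α r (y + 1)) m).le.trans
          (sum_partitionCoeff_le hα0 hα1 hr (by positivity) _))
      refine mul_le_of_le_one_left (partitionCoeff_nonneg hα0 hα1 r (by positivity) _) ?_
      exact (blockWeight_le hα1 r _).trans
        ((antitone_risingCoeff hα0 hα1 (Nat.zero_le _)).trans (risingCoeff_zero _).le)
  linarith

/-- The coefficients are of the order of Sibuya's probabilities, uniformly in `r`. -/
theorem exists_partitionCoeff_le {α : ℝ} (hα0 : 0 < α) (hα1 : α < 1) {y : ℝ} (hy : 0 < y) :
    ∃ E : ℝ, 0 ≤ E ∧ ∀ r, 2 ≤ r → ∀ l : ℕ,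
      partitionCoeff α r y l ≤ E * (risingCoeff (1 - α) l / ((l : ℝ) + 1)) := by
  have h1 : 0 < 1 - α := sub_pos.2 hα1
  obtain ⟨C, hC0, hC⟩ := exists_succ_mul_partitionCoeff_le hα0 hα1 (y := y + 1) (by positivity)
  set B : ℝ := α * y * (2 / (1 - α) * α ^ (-(y + 1)) + 2 * C / (1 - α)) with hB
  have hB0 : 0 ≤ B := by positivity
  refine ⟨1 + 2 * B / (1 - α), by positivity, fun r hr l => ?_⟩
  rcases l with _ | m
  · have : 0 ≤ 2 * B / (1 - α) := by positivity
    simpa using this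
  have hβ := risingCoeff_pos h1 m
  have hm : (0 : ℝ) < (m : ℝ) + 1 := by positivity
  have hfar := sum_far_le hα0 hα1 r m (partitionCoeff α r (y + 1)) (D := 2 * C / (m + 1))
    (by positivity) (fun l hl hml => by
      rw [le_div_iff₀ hm]
      have h2 := hC r hr l
      have h3 : (m : ℝ) + 1 ≤ 2 * (l + 1) := by exact_mod_cast (by omega : m + 1 ≤ 2 * (l + 1))
      have := mul_le_mul_of_nonneg_left h3
        (partitionCoeff_nonneg hα0 hα1 r (y := y + 1) (by positivity) l)
      linarith)
  have hnear := sum_near_le hα0 hα1 hr (y := y + 1) (by positivity) m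
  have hrec : ((m : ℝ) + 1) * partitionCoeff α r y (m + 1) ≤ B * risingCoeff (1 - α) m := by
    rw [succ_mul_partitionCoeff_succ,
      ← Finset.sum_filter_add_sum_filter_not _ (fun p : ℕ × ℕ => p.2 ≤ p.1), hB, mul_assoc (α * y)]
    refine mul_le_mul_of_nonneg_left ((add_le_add hnear hfar).trans (le_of_eq ?_)) (by positivity)
    field_simp
  have hβ' : (1 - α) * risingCoeff (1 - α) m ≤ risingCoeff (1 - α) (m + 1) * 1 := by
    have h := succ_mul_risingCoeff_succ (1 - α) m
    have hm0 : (0 : ℝ) ≤ m := by positivity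
    refine le_of_mul_le_mul_left ?_ hm
    nlinarith [mul_nonneg hβ.le (mul_nonneg hα0.le hm0)]
  have hU0 := partitionCoeff_nonneg hα0 hα1 r hy (m + 1)
  have hβ1 := risingCoeff_pos h1 (m + 1)
  push_cast
  rw [← mul_div_assoc, le_div_iff₀ (by positivity)]
  have h4 : partitionCoeff α r y (m + 1) * (m + 1 + 1) ≤ 2 * B * risingCoeff (1 - α) m := by
    have hm0 : (0 : ℝ) ≤ m := by positivity
    nlinarith
  have h5 : 2 * B * risingCoeff (1 - α) m ≤ 2 * B / (1 - α) * risingCoeff (1 - α) (m + 1) := by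
    rw [div_mul_eq_mul_div, le_div_iff₀ h1]
    nlinarith
  linarith

/-! ### The limit of the normalized convolution -/

theorem tendsto_risingCoeff_div_add {α : ℝ} (hα1 : α < 1) (l : ℕ) :
    Tendsto (fun m => risingCoeff (1 - α) m / risingCoeff (1 - α) (m + l)) atTop (nhds 1) := by
  have h1 : 0 < 1 - α := sub_pos.2 hα1
  have hne : ∀ m, risingCoeff (1 - α) m ≠ 0 := fun m => (risingCoeff_pos h1 m).ne'
  have hstep : Tendsto (fun m => risingCoeff (1 - α) m / risingCoeff (1 - α) (m + 1)) atTop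
      (nhds 1) := by
    have hd : Tendsto (fun m : ℕ => (m : ℝ) + (1 - α)) atTop atTop :=
      tendsto_atTop_add_const_right _ _ tendsto_natCast_atTop_atTop
    have h : Tendsto (fun m : ℕ => 1 + α / ((m : ℝ) + (1 - α))) atTop (nhds (1 + 0)) :=
      tendsto_const_nhds.add (hd.const_div_atTop _)
    rw [add_zero] at h
    refine h.congr fun m => ?_
    have h2 := succ_mul_risingCoeff_succ (1 - α) m
    have hm : (m : ℝ) + (1 - α) ≠ 0 := by positivity
    rw [eq_div_iff (hne _), ← mul_right_inj' hm]
    field_simp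
    linarith
  induction l with
  | zero => simp [div_self (hne _)]
  | succ l ih =>
    have h := ih.mul (hstep.comp (tendsto_add_atTop_nat l))
    rw [mul_one] at h
    exact h.congr fun m => div_mul_div_cancel₀ (hne _)

theorem tendsto_risingCoeff_sub_div {α : ℝ} (hα1 : α < 1) (l : ℕ) :
    Tendsto (fun m => risingCoeff (1 - α) (m - l) / risingCoeff (1 - α) m) atTop (nhds 1) := by
  refine ((tendsto_risingCoeff_div_add hα1 l).comp (tendsto_sub_atTop_nat l)).congr' ?_
  filter_upwards [eventually_ge_atTop l] with m hm
  simp [Nat.sub_add_cancel hm]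

theorem tendsto_far_div {α : ℝ} (hα0 : 0 < α) (hα1 : α < 1) {y : ℝ} (hy : 0 < y) {r : ℕ → ℕ}
    (hr2 : ∀ᶠ m in atTop, 2 ≤ r m) :
    Tendsto (fun m => (∑ p ∈ Finset.HasAntidiagonal.antidiagonal m with ¬ p.2 ≤ p.1,
      blockWeight α (r m) p.1 * partitionCoeff α (r m) y p.2) / risingCoeff (1 - α) m) atTop
      (nhds 0) := by
  have h1 : 0 < 1 - α := sub_pos.2 hα1
  obtain ⟨E, hE0, hE⟩ := exists_partitionCoeff_le hα0 hα1 hy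
  have hlim := (tendsto_risingCoeff_zero hα0 hα1).const_mul
    (E * (2 / (1 - α)) * 2 / (1 - α))
  rw [mul_zero] at hlim
  refine squeeze_zero' (Eventually.of_forall fun m => div_nonneg (Finset.sum_nonneg fun p _ =>
    mul_nonneg (blockWeight_nonneg hα1 _ _) (partitionCoeff_nonneg hα0 hα1 _ hy _))
    (risingCoeff_pos h1 m).le) ?_ hlim
  filter_upwards [hr2] with m hm
  have hβ := risingCoeff_pos h1 m
  have hm1 : (0 : ℝ) < (m : ℝ) + 1 := by positivity
  have hfar := sum_far_le hα0 hα1 (r m) m (partitionCoeff α (r m) y)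
    (D := E * (2 / (1 - α) * risingCoeff (1 - α) m * 2 / (m + 1))) (by positivity) (by
      intro l hl hml
      refine (hE _ hm l).trans (mul_le_mul_of_nonneg_left ?_ hE0)
      have h3 : (m : ℝ) + 1 ≤ 2 * (l + 1) := by exact_mod_cast (by omega : m + 1 ≤ 2 * (l + 1))
      have h4 := risingCoeff_le_of_le_two_mul hα1 hα0 hl hml.le
      have h5 := risingCoeff_pos h1 l
      rw [div_le_div_iff₀ (by positivity) hm1]
      calc _ ≤ risingCoeff (1 - α) l * (2 * (l + 1)) := mul_le_mul_of_nonneg_left h3 h5.le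
        _ ≤ 2 / (1 - α) * risingCoeff (1 - α) m * (2 * (l + 1)) :=
          mul_le_mul_of_nonneg_right h4 (by positivity)
        _ = _ := by ring)
  rw [div_le_iff₀ hβ]
  refine hfar.trans (le_of_eq ?_)
  field_simp

theorem sum_near_eq_tsum {α : ℝ} (r m : ℕ) (V : ℕ → ℝ) :
    (∑ p ∈ Finset.HasAntidiagonal.antidiagonal m with p.2 ≤ p.1,
      blockWeight α r p.1 * V p.2) / risingCoeff (1 - α) m =
    ∑' l, (if 2 * l ≤ m then blockWeight α r (m - l) / risingCoeff (1 - α) m else 0) * V l := by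
  rw [tsum_eq_sum (s := Finset.range (m + 1)) fun l hl => by
      rw [Finset.mem_range] at hl
      rw [if_neg (by omega), zero_mul],
    ← sum_antidiagonal_snd, Finset.sum_filter, Finset.sum_div]
  refine Finset.sum_congr rfl fun p hp => ?_
  rw [Finset.HasAntidiagonal.mem_antidiagonal] at hp
  rw [show m - p.2 = p.1 by omega, if_congr (show p.2 ≤ p.1 ↔ 2 * p.2 ≤ m by omega) rfl rfl]
  split_ifs
  · ring
  · simp

/-- Tannery's theorem for the main part of the convolution. The coefficients vary with `m`
through `r m`, so the difference from their total mass is shown to vanish. -/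
theorem tendsto_near_sub {α : ℝ} (hα0 : 0 < α) (hα1 : α < 1) {y : ℝ} (hy : 0 < y) {r : ℕ → ℕ}
    (hr2 : ∀ᶠ m in atTop, 2 ≤ r m) (hrm : ∀ᶠ m in atTop, 2 * r m ≤ m + 1) :
    Tendsto (fun m => (∑ p ∈ Finset.HasAntidiagonal.antidiagonal m with p.2 ≤ p.1,
      blockWeight α (r m) p.1 * partitionCoeff α (r m) y p.2) / risingCoeff (1 - α) m -
        (1 - risingCoeff (1 - α) (r m - 1)) ^ (-y)) atTop (nhds 0) := by
  have h1 : 0 < 1 - α := sub_pos.2 hα1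
  obtain ⟨E, hE0, hE⟩ := exists_partitionCoeff_le hα0 hα1 hy
  let f : ℕ → ℕ → ℝ := fun m l =>
    ((if 2 * l ≤ m then blockWeight α (r m) (m - l) / risingCoeff (1 - α) m else 0) - 1) *
      partitionCoeff α (r m) y l
  have hS : Summable fun l : ℕ => risingCoeff (1 - α) l / ((l : ℝ) + 1) := by
    refine ((hasSum_risingCoeff_tail hα0 hα1 0).summable.mul_left α⁻¹).congr fun l => ?_
    rw [if_pos (Nat.zero_le l)]
    field_simp
  have hbound : ∀ᶠ m in atTop, ∀ l, ‖f m l‖ ≤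
      (2 / (1 - α) + 1) * (E * (risingCoeff (1 - α) l / ((l : ℝ) + 1))) := by
    filter_upwards [hr2] with m hm l
    have hβ := risingCoeff_pos h1 m
    rw [norm_mul, Real.norm_eq_abs, Real.norm_eq_abs,
      abs_of_nonneg (partitionCoeff_nonneg hα0 hα1 _ hy l)]
    refine mul_le_mul ?_ (hE _ hm l) (partitionCoeff_nonneg hα0 hα1 _ hy l) (by positivity)
    have hK : 0 ≤ 2 / (1 - α) := by positivity
    split_ifs with h2
    · have h3 : blockWeight α (r m) (m - l) / risingCoeff (1 - α) m ≤ 2 / (1 - α) := by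
        rw [div_le_iff₀ hβ]
        exact (blockWeight_le hα1 _ _).trans
          (risingCoeff_le_of_le_two_mul hα1 hα0 (Nat.sub_le m l) (by omega))
      have h4 : 0 ≤ blockWeight α (r m) (m - l) / risingCoeff (1 - α) m :=
        div_nonneg (blockWeight_nonneg hα1 _ _) hβ.le
      rw [abs_le]
      constructor <;> linarith
    · rw [zero_sub, abs_neg, abs_one]
      linarith
  have hpoint : ∀ l, Tendsto (fun m => f m l) atTop (nhds 0) := by
    intro l
    have h2 := ((tendsto_risingCoeff_sub_div hα1 l).sub_const 1).abs.mul_const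
      (E * (risingCoeff (1 - α) l / ((l : ℝ) + 1)))
    rw [sub_self, abs_zero, zero_mul] at h2
    refine squeeze_zero_norm' ?_ h2
    filter_upwards [hr2, hrm, eventually_ge_atTop (2 * l)] with m hm hm' hml
    rw [norm_mul, Real.norm_eq_abs, Real.norm_eq_abs,
      abs_of_nonneg (partitionCoeff_nonneg hα0 hα1 _ hy l), if_pos hml, blockWeight,
      if_pos (by omega)]
    exact mul_le_mul_of_nonneg_left (hE _ hm l) (abs_nonneg _)
  have hT := tendsto_tsum_of_dominated_convergence ((hS.mul_left E).mul_left _) hpoint hbound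
  rw [tsum_zero] at hT
  refine hT.congr' ?_
  filter_upwards [hr2] with m hm
  have hsum := hasSum_partitionCoeff hα0 hα1 (r := r m) hy
    (by linarith [risingCoeff_pred_le hα0 hα1 hm])
  rw [sum_near_eq_tsum, ← hsum.tsum_eq, ← Summable.tsum_sub _ hsum.summable]
  · exact tsum_congr fun l => by simp only [f]; ring
  · refine summable_of_ne_finset_zero (s := Finset.range (m + 1)) fun l hl => ?_
    rw [Finset.mem_range] at hl
    rw [if_neg (by omega), zero_mul]

theorem tendsto_convolution_sub {α : ℝ} (hα0 : 0 < α) (hα1 : α < 1) {y : ℝ} (hy : 0 < y)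
    {r : ℕ → ℕ} (hr2 : ∀ᶠ m in atTop, 2 ≤ r m) (hrm : ∀ᶠ m in atTop, 2 * r m ≤ m + 1) :
    Tendsto (fun m => (∑ p ∈ Finset.HasAntidiagonal.antidiagonal m,
      blockWeight α (r m) p.1 * partitionCoeff α (r m) y p.2) / risingCoeff (1 - α) m -
        (1 - risingCoeff (1 - α) (r m - 1)) ^ (-y)) atTop (nhds 0) := by
  have h := (tendsto_near_sub hα0 hα1 hy hr2 hrm).add (tendsto_far_div hα0 hα1 hy hr2)
  rw [add_zero] at h
  refine h.congr fun m => ?_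
  rw [← Finset.sum_filter_add_sum_filter_not (Finset.HasAntidiagonal.antidiagonal m)
    (fun p : ℕ × ℕ => p.2 ≤ p.1)]
  ring

/-! ### Asymptotics of the probability -/

theorem probSmallestGE_isEquivalent {α θ : ℝ} (hα0 : 0 < α) (hα1 : α < 1) (hθ : -α < θ)
    {r : ℕ → ℕ} (hr2 : ∀ᶠ n in atTop, 2 ≤ r n)
    (hrn : (fun n => (r n : ℝ)) =o[atTop] (fun n => (n : ℝ))) :
    (fun n => probSmallestGE α θ n (r n)) ~[atTop]
      (fun n : ℕ => Real.Gamma (1 + θ) / Real.Gamma (1 - α) *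
        (∑ j ∈ Finset.Icc 1 (r n - 1), sibuya α j) ^ (-1 - θ / α) * (n : ℝ) ^ (-θ - α)) := by
  have h1 : 0 < 1 - α := sub_pos.2 hα1
  have hθ1 : 0 < θ + 1 := by linarith
  have hy : 0 < θ / α + 1 := by
    rw [div_add_one hα0.ne']
    exact div_pos (by linarith) hα0
  have hc : 0 < Real.Gamma (1 + θ) / Real.Gamma (1 - α) :=
    div_pos (Real.Gamma_pos_of_pos (by linarith)) (Real.Gamma_pos_of_pos h1)
  have hhalf : ∀ᶠ n in atTop, 2 * r n ≤ n := by
    filter_upwards [hrn.bound (show (0 : ℝ) < 1 / 2 by norm_num)] with n hn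
    rw [Real.norm_natCast, Real.norm_natCast] at hn
    exact_mod_cast (by linarith : 2 * (r n : ℝ) ≤ n)
  have hS : ∀ n, 2 ≤ r n → 0 < 1 - risingCoeff (1 - α) (r n - 1) ∧
      1 - risingCoeff (1 - α) (r n - 1) ≤ 1 := fun n hn =>
    ⟨by linarith [risingCoeff_pred_le hα0 hα1 hn], by linarith [risingCoeff_pos h1 (r n - 1)]⟩
  rw [show -1 - θ / α = -(θ / α + 1) by ring]
  simp_rw [sum_sibuya]
  rw [isEquivalent_iff_tendsto_one]
  swap
  · filter_upwards [hr2, eventually_gt_atTop 0] with n hn hn0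
    have := (hS n hn).1
    positivity
  rw [← tendsto_add_atTop_iff_nat 1]
  have hr2' := (tendsto_add_atTop_nat 1).eventually hr2
  have hconv := tendsto_convolution_sub hα0 hα1 hy hr2' ((tendsto_add_atTop_nat 1).eventually hhalf)
  -- the limit constant is at least `1`, so an error tending to `0` is also relatively small
  have hR : Tendsto (fun m => (∑ p ∈ Finset.HasAntidiagonal.antidiagonal m,
      blockWeight α (r (m + 1)) p.1 * partitionCoeff α (r (m + 1)) (θ / α + 1) p.2) /
        risingCoeff (1 - α) m / (1 - risingCoeff (1 - α) (r (m + 1) - 1)) ^ (-(θ / α + 1)))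
      atTop (nhds 1) := by
    rw [tendsto_iff_norm_sub_tendsto_zero]
    refine squeeze_zero' (Eventually.of_forall fun _ => norm_nonneg _) ?_
      (tendsto_zero_iff_norm_tendsto_zero.1 hconv)
    filter_upwards [hr2'] with m hm
    obtain ⟨hS0, hS1⟩ := hS _ hm
    have hpow : 1 ≤ (1 - risingCoeff (1 - α) (r (m + 1) - 1)) ^ (-(θ / α + 1)) :=
      Real.one_le_rpow_of_pos_of_le_one_of_nonpos hS0 hS1 (by linarith)
    rw [div_sub_one (by positivity), norm_div]
    exact div_le_self (norm_nonneg _) (hpow.trans (Real.le_norm_self _))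
  have hG := (tendsto_risingStep_div_mul_rpow h1 hθ1).div_const
    (Real.Gamma (1 + θ) / Real.Gamma (1 - α))
  rw [add_comm θ 1, div_self hc.ne'] at hG
  have h := hG.mul hR
  rw [mul_one] at h
  refine h.congr' ?_
  filter_upwards [hr2'] with m hm
  have hS0 := (hS _ hm).1
  have hpow := (Real.rpow_pos_of_pos hS0 (-(θ / α + 1))).ne'
  have hn : (0 : ℝ) < ((m + 1 : ℕ) : ℝ) := by positivity
  have hnpow := (Real.rpow_pos_of_pos hn (θ + α)).ne'
  have hβ := (risingStep_pos h1 zero_le_one m).ne'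
  have hT := (risingStep_pos (x := 1 + θ) (by linarith) zero_le_one m).ne'
  have hf : (m.factorial : ℝ) ≠ 0 := by positivity
  simp only [Pi.div_apply]
  rw [probSmallestGE_succ hα0 hα1 hθ, risingCoeff, show -θ - α = -(θ + α) by ring,
    Real.rpow_neg hn.le, show 1 + θ - (1 - α) = θ + α by ring, add_comm θ 1]
  field_simp

theorem mainTheorem1 (α θ : ℝ) (hα0 : 0 < α) (hα1 : α < 1) (hθ : -α < θ) :
    (∀ r : ℕ → ℕ, (∀ᶠ n in atTop, 2 ≤ r n) →
      (fun n => (r n : ℝ)) =o[atTop] (fun n => (n : ℝ)) →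
      (fun n => probSmallestGE α θ n (r n)) ~[atTop]
        (fun n : ℕ => Real.Gamma (1 + θ) / Real.Gamma (1 - α) *
          (∑ j ∈ Finset.Icc 1 (r n - 1), sibuya α j) ^ (-1 - θ / α) * (n : ℝ) ^ (-θ - α))) ∧
    (∀ r : ℕ → ℕ, Tendsto r atTop atTop →
      (fun n => (r n : ℝ)) =o[atTop] (fun n => (n : ℝ)) →
      (fun n => probSmallestGE α θ n (r n)) ~[atTop]
        (fun n : ℕ => Real.Gamma (1 + θ) / Real.Gamma (1 - α) * (n : ℝ) ^ (-θ - α))) := by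
  refine ⟨fun r hr2 hrn => probSmallestGE_isEquivalent hα0 hα1 hθ hr2 hrn, fun r hr hrn => ?_⟩
  refine (probSmallestGE_isEquivalent hα0 hα1 hθ (hr.eventually_ge_atTop 2) hrn).trans ?_
  -- the partial sums of Sibuya's distribution tend to `1`
  have hS : Tendsto (fun n => ∑ j ∈ Finset.Icc 1 (r n - 1), sibuya α j) atTop (nhds 1) := by
    simp_rw [sum_sibuya]
    have h := ((tendsto_risingCoeff_zero hα0 hα1).comp
      ((tendsto_sub_atTop_nat 1).comp hr)).const_sub 1
    rwa [sub_zero] at h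
  have hpow := hS.rpow_const (p := -1 - θ / α) (Or.inl one_ne_zero)
  rw [Real.one_rpow] at hpow
  have h1 := (isEquivalent_const_iff_tendsto one_ne_zero).2 hpow
  have h2 := ((IsEquivalent.refl (u := fun _ : ℕ => Real.Gamma (1 + θ) / Real.Gamma (1 - α))
    (l := atTop)).mul h1).mul (IsEquivalent.refl (u := fun n : ℕ => (n : ℝ) ^ (-θ - α)))
  refine h2.congr_right (Eventually.of_forall fun n => ?_)
  simp only [Pi.mul_apply, Function.const_apply, mul_one]

end
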